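/- Let $c:\mathbb R^m\to\mathbb R$ and $d:\mathbb R^m\to\mathbb R^p$ be twice continuously differentiable. For $x\in\mathbb R^p$ let $F(x)=\{y\in\mathbb R^m: d(y)\le x\}$ (componentwise), let $U(x)=\sup\{c(y):y\in F(x)\}\in[-\infty,+\infty]$, where $U(x)=-\infty$ if $F(x)=\emptyset$, and let $S(x)=\{y\in F(x):c(y)=U(x)\}$. Let $\bar y\in S(0)$, i.e. $\bar y$ is an optimal solution of $\max c(y)$ subject to $d(y)\le 0$. For $y\in\mathbb R^m$ let $$\Sigma(y)=\{\lambda\in\mathbb R^p:\ \nabla c(y)-\nabla d(y)\lambda=0,\ 0\le\lambda\perp -d(y)\ge 0\},$$ where the columns of $\nabla d(y)$ are the gradients of the components of $d$. *Stable CQ.* For a system $g(z)\le 0$, $h(z)=0$ on a Euclidean space, with solution set $Z$, let $M(\beta,z)$ be the set of all $(\lambda,\mu)$ with $\beta-\nabla g(z)\lambda-\nabla h(z)\mu=0$, $0\le\lambda\perp -g(z)\ge 0$ and $h(z)=0$. A condition on the points of $Z$ is a stable CQ for the system if at every $\bar z\in Z$ where it holds: it holds at all points of $Z$ near $\bar z$;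 for every continuously differentiable $\varphi$ that has a local maximum on $Z$ at $\bar z$, $M(\nabla\varphi(\bar z),\bar z)\neq\emptyset$; and whenever $\beta^k\to\bar\beta$, $z^k\to\bar z$ and $M(\beta^k,z^k)\ne\emptyset$ for all $k$, there are elements of $M(\beta^k,z^k)$ that converge, along a subsequence, to an element of $M(\bar\beta,\bar z)$. A stable CQ holds at $\bar z\in Z$ if some such condition holds at $\bar z$. *Restricted sup-compactness at $0$:* $U(0)$ is finite and there are $\epsilon,\delta>0$ and a compact set $\Omega\subseteq\mathbb R^m$ such that $S(x)\cap\Omega\ne\emptyset$ for all $x$ with $\|x\|<\delta$ and $U(x)>U(0)-\epsilon$. *Subdifferential.* At a point $x$ where $U$ is finite, $\widehat\partial U(x)$ is the set of all $v$ such that $U(x')\ge U(x)+\langle v,x'-x\rangle+o(\|x'-x\|)$ as $x'\to x$, and $\partial U(x)$ is the set of all limits of sequences $v^k\in\widehat\partial U(x^k)$ with $x^k\to x$ and $U(x^k)\to U(x)$. Assume that one of the following holds. 1. $c$ is concave, every component of $d$ is convex, restricted sup-compactness holds at $0$, a stable CQ for $d(y)\le 0$ holds at every $y\in S(0)$, and,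 for all $\tilde y\in S(0)$ and $\tilde\lambda\in\Sigma(\tilde y)$, a stable CQ for the system $\nabla c(y)-\nabla d(y)\lambda=0$, $\lambda\ge 0$ in the variable $(y,\lambda)$ holds at $(\tilde y,\tilde\lambda)$. 2. $c$ is strongly concave, every component of $d$ is convex, and a stable CQ for $d(y)\le 0$ holds at $\bar y$. 3. $c$ is strongly concave and $d$ is affine. Then $\partial U(0)\subseteq\Sigma(\bar y)$. Moreover, if $F(x)\neq\emptyset$ for all $x$ sufficiently close to $0$, then $U$ is Lipschitz continuous at $0$, i.e. $U$ is finite and Lipschitz on a neighborhood of $0$. -/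

import Mathlib

open Filter Topology Set

noncomputable section

namespace ShadowPrice

section Variational

variable {X : Type*} [NormedAddCommGroup X] [InnerProductSpace ℝ X]

/-- `φ` takes a finite value at `x`. -/
def FiniteAt (φ : X → EReal) (x : X) : Prop := φ x ≠ ⊥ ∧ φ x ≠ ⊤

/-- The regular (Fréchet) subdifferential of an extended-real-valued function:
`φ(x') ≥ φ(x) + ⟨v, x' - x⟩ + o(‖x' - x‖)`, at a point where `φ` is finite. -/
def regularSubdiff (φ : X → EReal) (x : X) : Set X :=
  {v | FiniteAt φ x ∧ ∀ ε : ℝ, 0 < ε → ∀ᶠ x' in 𝓝 x,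
    (((φ x).toReal + inner ℝ v (x' - x) - ε * ‖x' - x‖ : ℝ) : EReal) ≤ φ x'}

/-- The limiting (Mordukhovich) subdifferential of an extended-real-valued function. -/
def limitingSubdiff (φ : X → EReal) (x : X) : Set X :=
  {v | FiniteAt φ x ∧ ∃ (xs vs : ℕ → X), Tendsto xs atTop (𝓝 x) ∧
    Tendsto (fun k => φ (xs k)) atTop (𝓝 (φ x)) ∧
    (∀ k, vs k ∈ regularSubdiff φ (xs k)) ∧ Tendsto vs atTop (𝓝 v)}

/-- Lipschitz continuity at `x`: `φ` is finite and Lipschitz on a whole neighborhood of `x`. -/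
def LipschitzNear (φ : X → EReal) (x : X) : Prop :=
  ∃ s ∈ 𝓝 x, (∀ x' ∈ s, FiniteAt φ x') ∧
    ∃ K : NNReal, LipschitzOnWith K (fun x' => (φ x').toReal) s

end Variational

section Parametric

variable {X Y ι : Type*}

/-- The feasible set `F(x) = {y : g(x, y) ≤ 0}`. -/
def feasible (g : X → Y → ι → ℝ) (x : X) : Set Y := {y | ∀ i, g x y i ≤ 0}

/-- The maximal value function `V(x) = sup {f(x, y) : y ∈ F(x)}`, which is `-∞` if `F(x)` is
empty. -/
def valueFn (f : X → Y → ℝ) (g : X → Y → ι → ℝ) (x : X) : EReal :=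
  ⨆ y ∈ feasible g x, (f x y : EReal)

/-- The optimal solution map `S(x) = {y ∈ F(x) : f(x, y) = V(x)}`. -/
def solutions (f : X → Y → ℝ) (g : X → Y → ι → ℝ) (x : X) : Set Y :=
  {y ∈ feasible g x | (f x y : EReal) = valueFn f g x}

/-- Restricted sup-compactness at `x`. -/
def RestrictedSupCompact [NormedAddCommGroup X] [InnerProductSpace ℝ X] [TopologicalSpace Y]
    (f : X → Y → ℝ) (g : X → Y → ι → ℝ) (x : X) : Prop :=
  FiniteAt (valueFn f g) x ∧
    ∃ ε δ : ℝ, 0 < ε ∧ 0 < δ ∧ ∃ Ω : Set Y, IsCompact Ω ∧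
      ∀ x' ∈ Metric.ball x δ, valueFn f g x - (ε : EReal) < valueFn f g x' →
        (solutions f g x' ∩ Ω).Nonempty

end Parametric

section ConstraintQualifications

variable {E : Type*} [NormedAddCommGroup E] [InnerProductSpace ℝ E] [CompleteSpace E]
variable {ι κ : Type*} [Fintype ι] [Fintype κ]

/-- The solution set of the system `g(x) ≤ 0, h(x) = 0`. -/
def systemSet (g : ι → E → ℝ) (h : κ → E → ℝ) : Set E :=
  {x | (∀ i, g i x ≤ 0) ∧ ∀ j, h j x = 0}

/-- The set `M(β, x)` of all `(lam, mu)` such that `β - ∇g(x) lam - ∇h(x) mu = 0`,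
`0 ≤ lam ⊥ -g(x) ≥ 0` and `h(x) = 0`. -/
def multiplierSet (g : ι → E → ℝ) (h : κ → E → ℝ) (β x : E) : Set ((ι → ℝ) × (κ → ℝ)) :=
  {q | β - ∑ i, q.1 i • gradient (g i) x - ∑ j, q.2 j • gradient (h j) x = 0 ∧
    (∀ i, 0 ≤ q.1 i) ∧ x ∈ systemSet g h ∧ ∑ i, q.1 i * g i x = 0}

/-- Whatever the continuously differentiable objective is, the KKT conditions hold at `x` if `x`
is a local maximizer on the solution set of the system. -/
def KKTAt (g : ι → E → ℝ) (h : κ → E → ℝ) (x : E) : Prop :=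
  ∀ φ : E → ℝ, ContDiff ℝ 1 φ → IsLocalMaxOn φ (systemSet g h) x →
    (multiplierSet g h (gradient φ x) x).Nonempty

/-- Multiplier stability at `x`: if `βs k → β`, `xs k → x` and every `M(βs k, xs k)` is nonempty,
then there are multipliers in `M(βs k, xs k)` that converge, along a subsequence, to an element of
`M(β, x)`. -/
def MultiplierStableAt (g : ι → E → ℝ) (h : κ → E → ℝ) (x : E) : Prop :=
  ∀ (βs xs : ℕ → E) (β : E), Tendsto βs atTop (𝓝 β) → Tendsto xs atTop (𝓝 x) →
    (∀ k, (multiplierSet g h (βs k) (xs k)).Nonempty) →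
    ∃ qs : ℕ → (ι → ℝ) × (κ → ℝ), (∀ k, qs k ∈ multiplierSet g h (βs k) (xs k)) ∧
      ∃ q ∈ multiplierSet g h β x, ∃ σ : ℕ → ℕ, StrictMono σ ∧
        Tendsto (fun k => qs (σ k)) atTop (𝓝 q)

/-- A condition `Q` on the points of the solution set of the system is a stable constraint
qualification if at every point where it holds it is locally persistent, it ensures the KKT
conditions at local maximizers, and it ensures multiplier stability. -/
def IsStableCQ (g : ι → E → ℝ) (h : κ → E → ℝ) (Q : E → Prop) : Prop :=
  ∀ x ∈ systemSet g h, Q x →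
    (∀ᶠ x' in 𝓝[systemSet g h] x, Q x') ∧ KKTAt g h x ∧ MultiplierStableAt g h x

/-- A stable constraint qualification for the system `g ≤ 0, h = 0` holds at `x`. -/
def StableCQAt (g : ι → E → ℝ) (h : κ → E → ℝ) (x : E) : Prop :=
  x ∈ systemSet g h ∧ ∃ Q : E → Prop, IsStableCQ g h Q ∧ Q x

end ConstraintQualifications

section Canonical

variable {m p : ℕ}

/-- The canonically perturbed constraint function `(x, y) ↦ d(y) - x`. -/
def canonicalConstraint (d : EuclideanSpace ℝ (Fin m) → EuclideanSpace ℝ (Fin p)) :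
    EuclideanSpace ℝ (Fin p) → EuclideanSpace ℝ (Fin m) → Fin p → ℝ :=
  fun x y i => d y i - x i

/-- The objective `(x, y) ↦ c(y)`, which does not depend on the perturbation. -/
def canonicalObjective (p : ℕ) (c : EuclideanSpace ℝ (Fin m) → ℝ) :
    EuclideanSpace ℝ (Fin p) → EuclideanSpace ℝ (Fin m) → ℝ :=
  fun _ y => c y

/-- `U(x) = max {c(y) : d(y) - x ≤ 0}`. -/
def U (c : EuclideanSpace ℝ (Fin m) → ℝ)
    (d : EuclideanSpace ℝ (Fin m) → EuclideanSpace ℝ (Fin p)) :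
    EuclideanSpace ℝ (Fin p) → EReal :=
  valueFn (canonicalObjective p c) (canonicalConstraint d)

/-- The set of optimal solutions of `max c(y)` subject to `d(y) ≤ x`. -/
def S (c : EuclideanSpace ℝ (Fin m) → ℝ)
    (d : EuclideanSpace ℝ (Fin m) → EuclideanSpace ℝ (Fin p)) :
    EuclideanSpace ℝ (Fin p) → Set (EuclideanSpace ℝ (Fin m)) :=
  solutions (canonicalObjective p c) (canonicalConstraint d)

/-- `∇c(y) - ∇d(y) lam`. -/
def stationarity (c : EuclideanSpace ℝ (Fin m) → ℝ)
    (d : EuclideanSpace ℝ (Fin m) → EuclideanSpace ℝ (Fin p))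
    (y : EuclideanSpace ℝ (Fin m)) (lam : EuclideanSpace ℝ (Fin p)) :
    EuclideanSpace ℝ (Fin m) :=
  gradient c y - ∑ i, lam i • gradient (fun y' => d y' i) y

/-- The set of KKT multipliers at `y` of the problem `max c(y)` subject to `d(y) ≤ 0`. -/
def multipliers (c : EuclideanSpace ℝ (Fin m) → ℝ)
    (d : EuclideanSpace ℝ (Fin m) → EuclideanSpace ℝ (Fin p))
    (y : EuclideanSpace ℝ (Fin m)) : Set (EuclideanSpace ℝ (Fin p)) :=
  {lam | stationarity c d y lam = 0 ∧ (∀ i, 0 ≤ lam i) ∧ (∀ i, d y i ≤ 0) ∧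
    ∑ i, lam i * d y i = 0}

/-- A stable constraint qualification for `d(y) ≤ 0` (no equality constraints) holds at `y`. -/
def PrimalStableCQAt (d : EuclideanSpace ℝ (Fin m) → EuclideanSpace ℝ (Fin p))
    (y : EuclideanSpace ℝ (Fin m)) : Prop :=
  StableCQAt (fun (i : Fin p) y' => d y' i) (fun (j : Fin 0) _ => j.elim0) y

/-- A stable constraint qualification for the system `∇c(y) - ∇d(y) lam = 0`, `lam ≥ 0` in the
joint variable `(y, lam)` holds at `(y, lam)`. -/
def DualStableCQAt (c : EuclideanSpace ℝ (Fin m) → ℝ)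
    (d : EuclideanSpace ℝ (Fin m) → EuclideanSpace ℝ (Fin p))
    (y : EuclideanSpace ℝ (Fin m)) (lam : EuclideanSpace ℝ (Fin p)) : Prop :=
  StableCQAt (E := WithLp 2 (EuclideanSpace ℝ (Fin m) × EuclideanSpace ℝ (Fin p)))
    (fun (i : Fin p) z => -(z.snd i)) (fun (j : Fin m) z => stationarity c d z.fst z.snd j)
    (WithLp.toLp 2 (y, lam))

end Canonical

end ShadowPrice

end

namespace ShadowPrice

/-! Each of the three conditions makes `c` concave and every `d i` convex, so `U` is concave
(`hypographConvex_U`). For a concave function the local lower estimate defining a subgradient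
reverses into a global upper bound, and this bound survives limits, so every `v` in the limiting
subdifferential is a supergradient of `U` at `0`. Since `z` is feasible for the right-hand side `d
z`, this gives `c z ≤ U (d z) ≤ c ybar + ⟨v, d z⟩`: `ybar` maximizes the Lagrangian, which yields
stationarity and complementarity, while monotonicity of `U` gives `v ≥ 0`. The Lipschitz claim is
local Lipschitz continuity of finite concave functions in finite dimension. -/

lemma FiniteAt.coe_toReal {X : Type*} {φ : X → EReal} {x : X} (h : FiniteAt φ x) :
    ((φ x).toReal : EReal) = φ x :=
  EReal.coe_toReal h.2 h.1

section ConcaveEReal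

variable {X : Type*} [NormedAddCommGroup X] [InnerProductSpace ℝ X]

/-- Concavity of an extended-real-valued function: its hypograph is convex. -/
def HypographConvex (φ : X → EReal) : Prop :=
  ∀ (x₁ x₂ : X) (r₁ r₂ a b : ℝ), (r₁ : EReal) ≤ φ x₁ → (r₂ : EReal) ≤ φ x₂ → 0 ≤ a → 0 ≤ b →
    a + b = 1 → ((a * r₁ + b * r₂ : ℝ) : EReal) ≤ φ (a • x₁ + b • x₂)

/-- A regular subgradient of a concave function is a global supergradient. -/
lemma HypographConvex.le_of_mem_regularSubdiff {φ : X → EReal} (hφ : HypographConvex φ)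
    {x v : X} (hv : v ∈ regularSubdiff φ x) (x' : X) :
    φ x' ≤ (((φ x).toReal + inner ℝ v (x' - x) : ℝ) : EReal) := by
  obtain ⟨hfin, hsub⟩ := hv
  by_contra! hlt
  obtain ⟨r, hr, hrx⟩ := EReal.lt_iff_exists_real_btwn.1 hlt
  have hr : (φ x).toReal + inner ℝ v (x' - x) < r := by exact_mod_cast hr
  set q := (φ x).toReal
  set w := x' - x
  -- Half the gap, spread over `‖w‖ + 1` so that `w = 0` needs no separate case.
  set ε := (r - q - inner ℝ v w) / (2 * (‖w‖ + 1))
  have hw : 0 < ‖w‖ + 1 := by positivity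
  have hε : 0 < ε := div_pos (by linarith) (by positivity)
  have hεw : ε * ‖w‖ < r - q - inner ℝ v w := by
    have h : ε * (‖w‖ + 1) = (r - q - inner ℝ v w) / 2 := by
      simp only [ε]; field_simp
    linarith
  clear_value ε
  -- Step back from `x`, away from `x'`. Then `x` lies between `x - t • w` and `x'`, and the lower
  -- bounds at these two points force `φ x` above its own value.
  have htend : Tendsto (fun t : ℝ => x - t • w) (𝓝[>] 0) (𝓝 x) := by
    have : Tendsto (fun t : ℝ => x - t • w) (𝓝 0) (𝓝 (x - (0 : ℝ) • w)) :=
      Continuous.tendsto (by fun_prop) 0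
    simpa using this.mono_left nhdsWithin_le_nhds
  obtain ⟨t, ht, htpos⟩ := ((htend.eventually (hsub ε hε)).and self_mem_nhdsWithin).exists
  have htpos : 0 < t := htpos
  have h1 : (0 : ℝ) < 1 + t := by linarith
  have key := hφ (x - t • w) x' _ r (1 / (1 + t)) (t / (1 + t)) ht hrx.le (by positivity)
    (by positivity) (by field_simp)
  have hx : (1 / (1 + t)) • (x - t • w) + (t / (1 + t)) • x' = x := by
    have : x' = x + w := by simp [w]
    rw [this, smul_sub, smul_add, smul_smul, div_mul_eq_mul_div, one_mul]
    have h : (1 / (1 + t)) • x + (t / (1 + t)) • x = x := by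
      rw [← add_smul, ← add_div, div_self h1.ne', one_smul]
    calc _ = (1 / (1 + t)) • x + (t / (1 + t)) • x := by abel
      _ = x := h
  rw [hx, ← hfin.coe_toReal, EReal.coe_le_coe_iff, sub_sub_cancel_left, inner_neg_right,
    inner_smul_right, norm_neg, norm_smul, Real.norm_of_nonneg htpos.le, div_mul_eq_mul_div,
    div_mul_eq_mul_div, ← add_div, div_le_iff₀ h1] at key
  change _ ≤ q * (1 + t) at key
  have : t * (r - q - inner ℝ v w - ε * ‖w‖) ≤ 0 := by
    change 1 * (q + -(t * inner ℝ v w) - _) + _ ≤ _ at key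
    linarith
  nlinarith [mul_pos htpos (sub_pos.2 hεw)]

/-- A limiting subgradient of a concave function is a global supergradient. -/
lemma HypographConvex.le_of_mem_limitingSubdiff {φ : X → EReal} (hφ : HypographConvex φ)
    {x v : X} (hv : v ∈ limitingSubdiff φ x) (x' : X) :
    φ x' ≤ (((φ x).toReal + inner ℝ v (x' - x) : ℝ) : EReal) := by
  obtain ⟨hfin, xs, vs, hxs, hφxs, hvs, hv⟩ := hv
  have hlim : Tendsto (fun k => (φ (xs k)).toReal + inner ℝ (vs k) (x' - xs k)) atTop
      (𝓝 ((φ x).toReal + inner ℝ v (x' - x))) :=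
    ((EReal.tendsto_toReal hfin.2 hfin.1).comp hφxs).add
      (hv.inner (tendsto_const_nhds.sub hxs))
  exact ge_of_tendsto ((continuous_coe_real_ereal.tendsto _).comp hlim)
    (Eventually.of_forall fun k => hφ.le_of_mem_regularSubdiff (hvs k) x')

/-- A concave function that is finite at `x` and nowhere `-∞` near `x` is finite and Lipschitz
near `x`. -/
lemma HypographConvex.lipschitzNear [FiniteDimensional ℝ X] {φ : X → EReal}
    (hφ : HypographConvex φ) {x : X} (hx : φ x ≠ ⊤) (hbot : ∀ᶠ x' in 𝓝 x, φ x' ≠ ⊥) :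
    LipschitzNear φ x := by
  obtain ⟨δ, hδ, hball⟩ := Metric.eventually_nhds_iff_ball.1 hbot
  have hfin : ∀ x' ∈ Metric.ball x δ, FiniteAt φ x' := by
    refine fun x' hx' => ⟨hball x' hx', fun htop => hx ?_⟩
    -- `x` is the midpoint of `x'` and its reflection, where `φ` is not `⊥`; hence `φ x' = ⊤` would
    -- force `φ x = ⊤`.
    have hrefl : x + x - x' ∈ Metric.ball x δ := by
      rw [mem_ball_iff_norm] at hx' ⊢
      rwa [show x + x - x' - x = -(x' - x) by abel, norm_neg]
    obtain ⟨s, -, hs⟩ := EReal.lt_iff_exists_real_btwn.1 (bot_lt_iff_ne_bot.2 (hball _ hrefl))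
    refine EReal.eq_top_iff_forall_lt _ |>.2 fun r => ?_
    -- The height `2 * (r + 1) - s` makes the average with `s` equal to `r + 1`.
    have key := hφ x' (x + x - x') (2 * (r + 1) - s) s (1 / 2) (1 / 2) (by simp [htop]) hs.le
      (by norm_num) (by norm_num) (by norm_num)
    have hmid : (1 / 2 : ℝ) • x' + (1 / 2 : ℝ) • (x + x - x') = x := by module
    rw [hmid] at key
    refine lt_of_lt_of_le ?_ key
    rw [EReal.coe_lt_coe_iff]
    linarith
  have hconc : ConcaveOn ℝ (Metric.ball x δ) fun x' => (φ x').toReal := by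
    refine ⟨convex_ball x δ, fun x₁ h₁ x₂ h₂ a b ha hb hab => ?_⟩
    have key := hφ x₁ x₂ _ _ a b (hfin x₁ h₁).coe_toReal.le (hfin x₂ h₂).coe_toReal.le ha hb hab
    rw [← (hfin _ (convex_ball x δ h₁ h₂ ha hb hab)).coe_toReal, EReal.coe_le_coe_iff] at key
    exact key
  obtain ⟨K, t, ht, hK⟩ :=
    hconc.locallyLipschitzOn Metric.isOpen_ball (Metric.mem_ball_self hδ)
  rw [Metric.isOpen_ball.nhdsWithin_eq (Metric.mem_ball_self hδ)] at ht
  exact ⟨t ∩ Metric.ball x δ, inter_mem ht (Metric.ball_mem_nhds x hδ),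
    fun x' hx' => hfin x' hx'.2, K, hK.mono inter_subset_left⟩

end ConcaveEReal

section CanonicalConcave

variable {m p : ℕ} {c : EuclideanSpace ℝ (Fin m) → ℝ}
  {d : EuclideanSpace ℝ (Fin m) → EuclideanSpace ℝ (Fin p)}

lemma le_U {x : EuclideanSpace ℝ (Fin p)} {y : EuclideanSpace ℝ (Fin m)}
    (h : ∀ i, d y i ≤ x i) : (c y : EReal) ≤ U c d x :=
  le_iSup₂_of_le (f := fun y (_ : y ∈ feasible (canonicalConstraint d) x) => (c y : EReal)) y
    (fun i => sub_nonpos.2 (h i)) le_rfl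

/-- Supplies near-optimal feasible points where the supremum need not be attained. -/
lemma lt_U_iff {x : EuclideanSpace ℝ (Fin p)} {r : ℝ} :
    (r : EReal) < U c d x ↔ ∃ y, (∀ i, d y i ≤ x i) ∧ r < c y := by
  simp [U, valueFn, lt_iSup_iff, feasible, canonicalConstraint, canonicalObjective]

lemma U_mono {x x' : EuclideanSpace ℝ (Fin p)} (h : ∀ i, x i ≤ x' i) : U c d x ≤ U c d x' :=
  iSup₂_le fun _ hy => le_U fun i => (sub_nonpos.1 (hy i)).trans (h i)

/-- The optimal value of a convex program is a concave function of the right-hand side. -/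
lemma hypographConvex_U (hc : ConcaveOn ℝ univ c)
    (hd : ∀ i, ConvexOn ℝ univ fun y => d y i) : HypographConvex (U c d) := by
  intro x₁ x₂ r₁ r₂ a b h₁ h₂ ha hb hab
  refine le_of_forall_lt fun z hz => ?_
  obtain ⟨s, hzs, hs⟩ := EReal.lt_iff_exists_real_btwn.1 hz
  refine hzs.trans ?_
  have hs : s < a * r₁ + b * r₂ := by exact_mod_cast hs
  set ε := a * r₁ + b * r₂ - s
  have hε : 0 < ε := sub_pos.2 hs
  obtain ⟨y₁, hy₁, hc₁⟩ := lt_U_iff.1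
    (lt_of_lt_of_le (EReal.coe_lt_coe_iff.2 (sub_lt_self r₁ hε)) h₁)
  obtain ⟨y₂, hy₂, hc₂⟩ := lt_U_iff.1
    (lt_of_lt_of_le (EReal.coe_lt_coe_iff.2 (sub_lt_self r₂ hε)) h₂)
  refine lt_U_iff.2 ⟨a • y₁ + b • y₂, fun i => ?_, lt_of_lt_of_le ?_
    (hc.2 (mem_univ y₁) (mem_univ y₂) ha hb hab)⟩
  · refine ((hd i).2 (mem_univ y₁) (mem_univ y₂) ha hb hab).trans ?_
    simpa using add_le_add (mul_le_mul_of_nonneg_left (hy₁ i) ha)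
      (mul_le_mul_of_nonneg_left (hy₂ i) hb)
  · have hs' : s = a * (r₁ - ε) + b * (r₂ - ε) := by
      linear_combination ε * hab
    rw [hs', smul_eq_mul, smul_eq_mul]
    -- Strictness comes from a summand with positive weight: the second if `a = 0`, otherwise the
    -- first.
    rcases ha.eq_or_lt with rfl | ha'
    · nlinarith
    · exact add_lt_add_of_lt_of_le (mul_lt_mul_of_pos_left hc₁ ha')
        (mul_le_mul_of_nonneg_left hc₂.le hb)

/-- The supergradients at `0` of the optimal value function are KKT multipliers at every optimal
solution. -/
lemma mem_multipliers_of_supergradient (hc : Differentiable ℝ c) (hd : Differentiable ℝ d)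
    {y : EuclideanSpace ℝ (Fin m)} (hy : y ∈ S c d 0) {v : EuclideanSpace ℝ (Fin p)}
    (hv : ∀ x, U c d x ≤ ((c y + inner ℝ v x : ℝ) : EReal)) : v ∈ multipliers c d y := by
  have hfeas : ∀ i, d y i ≤ 0 := fun i => by simpa [canonicalConstraint] using hy.1 i
  have hUy : (c y : EReal) = U c d 0 := hy.2
  have hinner : ∀ x, inner ℝ v x = ∑ i, v i * x i := fun x => by
    simp [PiLp.inner_apply, mul_comm]
  have hbound : ∀ z, c z ≤ c y + inner ℝ v (d z) := fun z =>
    EReal.coe_le_coe_iff.1 ((le_U fun _ => le_rfl).trans (hv (d z)))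
  -- Relaxing the `i`-th constraint by one unit cannot lower `U`, and the supergradient bound caps
  -- the gain at `v i`.
  have hnonneg : ∀ i, 0 ≤ v i := fun i => by
    have h : U c d 0 ≤ U c d (EuclideanSpace.single i 1) := U_mono fun j => by
      by_cases hj : j = i <;> simp [hj]
    have h' := h.trans (hv _)
    rw [← hUy, EReal.coe_le_coe_iff] at h'
    simpa [hinner, PiLp.single_apply] using h'
  have hslack : ∑ i, v i * d y i = 0 := by
    refine le_antisymm (Finset.sum_nonpos fun i _ =>
      mul_nonpos_of_nonneg_of_nonpos (hnonneg i) (hfeas i)) ?_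
    -- At `z = y` the bound reads `0 ≤ ⟨v, d y⟩`.
    have := hbound y
    rw [hinner] at this
    linarith
  refine ⟨?_, hnonneg, hfeas, hslack⟩
  have hmax : IsLocalMax (fun z => c z - ∑ i, v i * d z i) y := Eventually.of_forall fun z => by
    have := hbound z
    rw [hinner] at this
    simp only [hslack]
    linarith
  have hdi : ∀ i, DifferentiableAt ℝ (fun z => d z i) y := fun i =>
    (differentiable_euclidean.1 hd i).differentiableAt
  have hgrad : HasGradientAt (fun z => c z - ∑ i, v i * d z i) (stationarity c d y v) y := by
    rw [hasGradientAt_iff_hasFDerivAt, stationarity, map_sub, map_sum]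
    simp only [map_smul]
    exact (hasGradientAt_iff_hasFDerivAt.1 (hc y).hasGradientAt).sub
      (HasFDerivAt.fun_sum fun i _ =>
        (hasGradientAt_iff_hasFDerivAt.1 (hdi i).hasGradientAt).const_mul (v i))
  have h0 := hmax.hasFDerivAt_eq_zero (hasGradientAt_iff_hasFDerivAt.1 hgrad)
  simpa using h0

/-- For a convex program, every limiting subgradient of the optimal value function is a KKT
multiplier, and the optimal value function is Lipschitz near `0` if the program is feasible for all
small perturbations. -/
theorem limitingSubdiff_subset_and_lipschitzNear (hc : Differentiable ℝ c)
    (hd : Differentiable ℝ d) (hcc : ConcaveOn ℝ univ c)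
    (hdc : ∀ i, ConvexOn ℝ univ fun y => d y i) {y : EuclideanSpace ℝ (Fin m)}
    (hy : y ∈ S c d 0) :
    limitingSubdiff (U c d) 0 ⊆ multipliers c d y ∧
    ((∀ᶠ x in 𝓝 (0 : EuclideanSpace ℝ (Fin p)), ∃ z, ∀ i, d z i ≤ x i) →
      LipschitzNear (U c d) 0) := by
  have hU := hypographConvex_U hcc hdc
  have hUy : U c d 0 = (c y : EReal) := hy.2.symm
  refine ⟨fun v hv => mem_multipliers_of_supergradient hc hd hy fun x => ?_, fun hfeas => ?_⟩
  · simpa [hUy] using hU.le_of_mem_limitingSubdiff hv x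
  · refine hU.lipschitzNear (by simp [hUy]) (hfeas.mono ?_)
    rintro x ⟨z, hz⟩ hbot
    exact EReal.coe_ne_bot _ (le_bot_iff.1 ((le_U hz).trans hbot.le))

lemma convexOn_coord_of_affine (A : EuclideanSpace ℝ (Fin m) →ᵃ[ℝ] EuclideanSpace ℝ (Fin p))
    (i : Fin p) : ConvexOn ℝ univ fun y => A y i := by
  refine ⟨convex_univ, fun y₁ _ y₂ _ a b _ _ hab => le_of_eq ?_⟩
  simp [Convex.combo_affine_apply hab]

end CanonicalConcave

end ShadowPrice

theorem mainTheorem11 {m p : ℕ} (c : EuclideanSpace ℝ (Fin m) → ℝ)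
    (d : EuclideanSpace ℝ (Fin m) → EuclideanSpace ℝ (Fin p))
    (hc : ContDiff ℝ 2 c) (hd : ContDiff ℝ 2 d)
    (ybar : EuclideanSpace ℝ (Fin m)) (hy : ybar ∈ ShadowPrice.S c d 0)
    (hcond :
      -- 1)
      (ConcaveOn ℝ Set.univ c ∧ (∀ i, ConvexOn ℝ Set.univ (fun y => d y i)) ∧
        ShadowPrice.RestrictedSupCompact (ShadowPrice.canonicalObjective p c)
          (ShadowPrice.canonicalConstraint d) 0 ∧
        (∀ y ∈ ShadowPrice.S c d 0, ShadowPrice.PrimalStableCQAt d y) ∧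
        (∀ y ∈ ShadowPrice.S c d 0, ∀ lam ∈ ShadowPrice.multipliers c d y,
          ShadowPrice.DualStableCQAt c d y lam)) ∨
      -- 2)
      ((∃ μ : ℝ, 0 < μ ∧ StrongConcaveOn Set.univ μ c) ∧
        (∀ i, ConvexOn ℝ Set.univ (fun y => d y i)) ∧
        ShadowPrice.PrimalStableCQAt d ybar) ∨
      -- 3)
      ((∃ μ : ℝ, 0 < μ ∧ StrongConcaveOn Set.univ μ c) ∧
        ∃ A : EuclideanSpace ℝ (Fin m) →ᵃ[ℝ] EuclideanSpace ℝ (Fin p), ∀ y, d y = A y)) :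
    ShadowPrice.limitingSubdiff (ShadowPrice.U c d) 0 ⊆ ShadowPrice.multipliers c d ybar ∧
    ((∀ᶠ x in nhds (0 : EuclideanSpace ℝ (Fin p)), ∃ y, ∀ i, d y i ≤ x i) →
      ShadowPrice.LipschitzNear (ShadowPrice.U c d) 0) := by
  have hc' : Differentiable ℝ c := hc.differentiable (by norm_num)
  have hd' : Differentiable ℝ d := hd.differentiable (by norm_num)
  have hstrong : (∃ μ : ℝ, 0 < μ ∧ StrongConcaveOn Set.univ μ c) → ConcaveOn ℝ Set.univ c :=
    fun ⟨_, hμ, h⟩ => UniformConcaveOn.concaveOn h fun r => by positivity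
  rcases hcond with ⟨hcc, hdc, -⟩ | ⟨hcc, hdc, -⟩ | ⟨hcc, A, hA⟩
  · exact ShadowPrice.limitingSubdiff_subset_and_lipschitzNear hc' hd' hcc hdc hy
  · exact ShadowPrice.limitingSubdiff_subset_and_lipschitzNear hc' hd' (hstrong hcc) hdc hy
  · exact ShadowPrice.limitingSubdiff_subset_and_lipschitzNear hc' hd' (hstrong hcc)
      (fun i => by simpa only [hA] using ShadowPrice.convexOn_coord_of_affine A i) hy
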